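/- **Theorem S.2 (WAY theorem for unitary channels and group symmetries).** Let $\mathcal H_S,\mathcal H_P,\mathcal H_{S'},\mathcal H_{P'}$ be complex Hilbert spaces of arbitrary dimension, let $\otimes$ denote the Hilbert space tensor product, and let $U_{S\to S'}\colon\mathcal H_S\to\mathcal H_{S'}$ be a unitary operator, with associated unitary channel $\mathcal U_{S\to S'}(\rho)=U_{S\to S'}\,\rho\,U_{S\to S'}^\dagger$. Let $(\mathcal H_P,\mathcal H_{S'},\mathcal H_{P'},\rho_P,U)$ be a system-environment model, that is, $\rho_P$ is a density operator (a non-negative trace-class operator of unit trace) on $\mathcal H_P$ and $U\colon\mathcal H_S\otimes\mathcal H_P\to\mathcal H_{S'}\otimes\mathcal H_{P'}$ is a unitary operator. Suppose that the model implements $\mathcal U_{S\to S'}$, that is, $$\mathcal U_{S\to S'}(\rho_S)=\mathrm{Tr}_{P'}\bigl[U(\rho_S\otimes\rho_P)U^\dagger\bigr]\quad\text{for every density operator }\rho_S\text{ on }\mathcal H_S,$$ where $\mathrm{Tr}_{P'}$ denotes the partial trace over $\mathcal H_{P'}$. Let $G$ be a connected topological group, and let $(U^S_g)_{g\in G}$,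 $(U^P_g)_{g\in G}$, $(U^{S'}_g)_{g\in G}$, $(U^{P'}_g)_{g\in G}$ be strongly continuous unitary representations of $G$ on $\mathcal H_S,\mathcal H_P,\mathcal H_{S'},\mathcal H_{P'}$, respectively, satisfying the $G$-invariance condition $$U^\dagger\,(U^{S'}_g\otimes U^{P'}_g)\,U=U^S_g\otimes U^P_g\qquad(g\in G).$$ Then there exists a continuous group homomorphism $G\ni g\mapsto c_g\in\mathrm U(1)=\{c\in\mathbb C:|c|=1\}$ such that $$U_{S\to S'}^\dagger\,U^{S'}_g\,U_{S\to S'}=c_g\,U^S_g\qquad(g\in G).$$ -/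

import Mathlib

open scoped TensorProduct InnerProduct

namespace WAY

noncomputable section

section Operators

variable {H : Type*} [NormedAddCommGroup H] [InnerProductSpace ℂ H] [CompleteSpace H]

variable (H) in
/-- The index set of a fixed Hilbert basis (complete orthonormal system) of `H`. -/
def basisSet : Set H := (exists_hilbertBasis ℂ H).choose

variable (H) in
/-- A fixed Hilbert basis of `H`. It is only used to define trace class operators, the trace and
the partial trace, none of which depend on the choice. -/
def basis : HilbertBasis (basisSet H) ℂ H := (exists_hilbertBasis ℂ H).choose_spec.choose

/-- A bounded operator `T` is trace class if `∑ᵢ ⟨eᵢ, |T| eᵢ⟩ < ∞`, where `|T| = (T† T)^{1/2}`. -/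
def IsTraceClass (T : H →L[ℂ] H) : Prop :=
  Summable fun i => (inner ℂ (basis H i) (CFC.abs T (basis H i))).re

/-- The trace `∑ᵢ ⟨eᵢ, T eᵢ⟩` (meaningful for trace class operators `T`). -/
def trace (T : H →L[ℂ] H) : ℂ :=
  ∑' i, inner ℂ (basis H i) (T (basis H i))

/-- Density operators: non-negative trace class operators of unit trace. -/
structure IsDensityOperator (T : H →L[ℂ] H) : Prop where
  isPositive : T.IsPositive
  isTraceClass : IsTraceClass T
  trace_eq_one : trace T = 1

end Operators

section Tensor

/-- The Hilbert space tensor product: the completion of the algebraic tensor product for the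
inner product with `⟨x ⊗ y, x' ⊗ y'⟩ = ⟨x, x'⟩ ⟨y, y'⟩`. -/
abbrev HilbertTensor (H K : Type*) [NormedAddCommGroup H] [InnerProductSpace ℂ H]
    [NormedAddCommGroup K] [InnerProductSpace ℂ K] : Type _ :=
  UniformSpace.Completion (H ⊗[ℂ] K)

variable {H : Type*} [NormedAddCommGroup H] [InnerProductSpace ℂ H]
  {K : Type*} [NormedAddCommGroup K] [InnerProductSpace ℂ K]

/-- The tensor product `a ⊗ b` of bounded operators, as a bounded operator on the Hilbert space
tensor product: the unique bounded operator with `x ⊗ y ↦ a x ⊗ b y`. -/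
def tensorOp (a : H →L[ℂ] H) (b : K →L[ℂ] K) : HilbertTensor H K →L[ℂ] HilbertTensor H K :=
  (TensorProduct.mapL a b).completion

variable (H) in
/-- The bounded operator `x ↦ x ⊗ y` from `H` to `H ⊗ K`. -/
def tensorRight (y : K) : H →L[ℂ] HilbertTensor H K :=
  UniformSpace.Completion.toComplL.comp ((TensorProduct.mkL ℂ H K).flip y)

/-- The partial trace over `K`, `∑ᵢ (1 ⊗ ⟨eᵢ|) T (1 ⊗ |eᵢ⟩)`, the sum being over a Hilbert basis
of `K`. For trace class `T` this series of bounded operators converges absolutely (even in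
trace norm). -/
def partialTrace [CompleteSpace H] [CompleteSpace K]
    (T : HilbertTensor H K →L[ℂ] HilbertTensor H K) : H →L[ℂ] H :=
  ∑' i, (tensorRight H (basis K i))† ∘L T ∘L tensorRight H (basis K i)

end Tensor

section Unitary

variable {H : Type*} [NormedAddCommGroup H] [InnerProductSpace ℂ H] [CompleteSpace H]
  {K : Type*} [NormedAddCommGroup K] [InnerProductSpace ℂ K] [CompleteSpace K]

/-- A unitary operator `V : H → K`, regarded as a bounded operator. -/
def unitaryOp (V : H ≃ₗᵢ[ℂ] K) : H →L[ℂ] K := V.toContinuousLinearEquiv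

/-- The unitary channel `ρ ↦ V ρ V†`. -/
def unitaryChannel (V : H ≃ₗᵢ[ℂ] K) (ρ : H →L[ℂ] H) : K →L[ℂ] K :=
  unitaryOp V ∘L ρ ∘L (unitaryOp V)†

/-- Strong continuity of a unitary representation: continuity for the strong operator topology,
i.e. continuity of `g ↦ U_g ξ` for every vector `ξ`. -/
def StronglyContinuous {G : Type*} [Group G] [TopologicalSpace G]
    (R : G →* unitary (H →L[ℂ] H)) : Prop :=
  ∀ ξ : H, Continuous fun g => (R g : H →L[ℂ] H) ξ

end Unitary

section Model

variable (S P S' P' : Type*)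
  [NormedAddCommGroup S] [InnerProductSpace ℂ S] [CompleteSpace S]
  [NormedAddCommGroup P] [InnerProductSpace ℂ P] [CompleteSpace P]
  [NormedAddCommGroup S'] [InnerProductSpace ℂ S'] [CompleteSpace S']
  [NormedAddCommGroup P'] [InnerProductSpace ℂ P'] [CompleteSpace P']

/-- A system-environment model `(P, S', P', ρ_P, U)` for the input system `S`: a probe state
`ρ_P` on `P` and a unitary operator `U : S ⊗ P → S' ⊗ P'`. -/
structure SystemEnvironmentModel where
  /-- The probe state. -/
  probe : P →L[ℂ] P
  isDensityOperator_probe : IsDensityOperator probe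
  /-- The interaction. -/
  U : HilbertTensor S P ≃ₗᵢ[ℂ] HilbertTensor S' P'

variable {S P S' P'}

/-- The model implements `Ψ` if `Ψ ρ = Tr_{P'} [U (ρ ⊗ ρ_P) U†]` for every density operator `ρ`
on `S`. -/
def SystemEnvironmentModel.Implements (M : SystemEnvironmentModel S P S' P')
    (Ψ : (S →L[ℂ] S) → (S' →L[ℂ] S')) : Prop :=
  ∀ ρ : S →L[ℂ] S, IsDensityOperator ρ →
    Ψ ρ = partialTrace (unitaryOp M.U ∘L tensorOp ρ M.probe ∘L (unitaryOp M.U)†)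

/-- The `G`-invariance condition `U† (U_g^{S'} ⊗ U_g^{P'}) U = U_g^S ⊗ U_g^P` for all `g`. -/
def SystemEnvironmentModel.GInvariant {G : Type*} [Group G] (M : SystemEnvironmentModel S P S' P')
    (RS : G →* unitary (S →L[ℂ] S)) (RP : G →* unitary (P →L[ℂ] P))
    (RS' : G →* unitary (S' →L[ℂ] S')) (RP' : G →* unitary (P' →L[ℂ] P')) : Prop :=
  ∀ g : G, (unitaryOp M.U)† ∘L tensorOp (RS' g : S' →L[ℂ] S') (RP' g : P' →L[ℂ] P') ∘L
    unitaryOp M.U = tensorOp (RS g : S →L[ℂ] S) (RP g : P →L[ℂ] P)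

end Model

end

end WAY

/-!
A unitary channel maps pure states to pure states. If the model implements `ρ ↦ V ρ V†` and `x` is a
unit vector, then the expectation of the output state `|V x⟩⟨V x|` in any `ξ ⟂ V x` is zero; written
with the partial trace, it is a series of nonnegative terms, so every term vanishes
(`inner_basis_eq_zero`). Hence `U (x ⊗ φ)` is orthogonal to `ξ ⊗ b` for all `b` and every `φ` in the
range of the probe state, i.e. `U (x ⊗ φ) = V x ⊗ ψ`, and by linearity `ψ` does not depend on `x`
(`exists_factorization`). The probe state has unit trace, so `φ`, and with it `ψ`, can be taken
nonzero.

The matrix elements of the invariance condition between vectors `x ⊗ φ` now read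
`⟨φ, U^P_g φ⟩ U^S_g = ⟨ψ, U^{P'}_g ψ⟩ V† U^{S'}_g V` (`smul_eq_smul_transport`). At `g = 1` the scalar
on the right is `‖ψ‖² ≠ 0`, so by continuity the representations `U^S` and `V† U^{S'} V` are
proportional near the identity. The elements at which they are proportional form an open subgroup,
which is everything because `G` is connected (`exists_smul_eq_of_eventually`). The factors are
matrix elements of the two representations, and form a continuous character (`exists_character`).

Convergence of the series defining the partial trace needs no separate proof: a divergent series
would have the value `0`, whereas the output state `|V x⟩⟨V x|` is nonzero.
-/

namespace WAY

/-! ### Simple tensors in the Hilbert space tensor product -/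

section Tensor

variable {H : Type*} [NormedAddCommGroup H] [InnerProductSpace ℂ H]
  {K : Type*} [NormedAddCommGroup K] [InnerProductSpace ℂ K]

/-- The simple tensor `x ⊗ y`, as an element of the Hilbert space tensor product. -/
noncomputable def simpleTensor (x : H) (y : K) : HilbertTensor H K := (x ⊗ₜ[ℂ] y : H ⊗[ℂ] K)

@[simp]
theorem tensorRight_apply (x : H) (y : K) : tensorRight H y x = simpleTensor x y := rfl

variable (K) in
/-- The bounded operator `y ↦ x ⊗ y` from `K` to `H ⊗ K`. -/
noncomputable def tensorLeft (x : H) : K →L[ℂ] HilbertTensor H K :=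
  UniformSpace.Completion.toComplL.comp (TensorProduct.mkL ℂ H K x)

@[simp]
theorem tensorLeft_apply (x : H) (y : K) : tensorLeft K x y = simpleTensor x y := rfl

@[simp]
theorem tensorOp_simpleTensor (a : H →L[ℂ] H) (b : K →L[ℂ] K) (x : H) (y : K) :
    tensorOp a b (simpleTensor x y) = simpleTensor (a x) (b y) :=
  ContinuousLinearMap.completion_apply_coe _ _

@[simp]
theorem inner_simpleTensor (x x' : H) (y y' : K) :
    inner ℂ (simpleTensor x y) (simpleTensor x' y') = inner ℂ x x' * inner ℂ y y' := by
  simp [simpleTensor]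

theorem smul_simpleTensor (c : ℂ) (x : H) (y : K) :
    simpleTensor (c • x) y = c • simpleTensor x y :=
  map_smul (tensorRight H y) c x

/-- Bounded operators on the Hilbert space tensor product are determined by simple tensors. -/
theorem clm_ext_simpleTensor {E : Type*} [NormedAddCommGroup E] [NormedSpace ℂ E]
    {A B : HilbertTensor H K →L[ℂ] E}
    (h : ∀ x y, A (simpleTensor x y) = B (simpleTensor x y)) : A = B := by
  ext w
  induction w using UniformSpace.Completion.induction_on with
  | hp => exact isClosed_eq A.continuous B.continuous
  | ih w =>
    induction w using TensorProduct.induction_on with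
    | zero => rw [UniformSpace.Completion.coe_zero, map_zero, map_zero]
    | tmul x y => exact h x y
    | add u v hu hv => simp only [UniformSpace.Completion.coe_add, map_add, hu, hv]

theorem ext_inner_simpleTensor {w w' : HilbertTensor H K}
    (h : ∀ x y, inner ℂ (simpleTensor x y) w = inner ℂ (simpleTensor x y) w') : w = w' := by
  have : innerSL ℂ w = innerSL ℂ w' := clm_ext_simpleTensor fun x y => by
    change inner ℂ w _ = inner ℂ w' _
    rw [← inner_conj_symm, h, inner_conj_symm]
  exact ext_inner_right ℂ fun v => congrArg (· v) this

/-- For a pure state `|x⟩⟨x|`, the operator `|x⟩⟨x| ⊗ b` is `L b L†` with `L = x ⊗ ·`; this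
exhibits its positivity for positive `b`. -/
theorem tensorOp_rankOne_self [CompleteSpace K] (x : H) (b : K →L[ℂ] K) :
    tensorOp (InnerProductSpace.rankOne ℂ x x) b = tensorLeft K x ∘L b ∘L (tensorLeft K x)† := by
  refine clm_ext_simpleTensor fun x' y' => ?_
  have : ((tensorLeft K x)†) (simpleTensor x' y') = inner ℂ x x' • y' :=
    ext_inner_left ℂ fun v => by
      simp [ContinuousLinearMap.adjoint_inner_right, inner_smul_right]
  simp only [ContinuousLinearMap.comp_apply, this, tensorOp_simpleTensor,
    InnerProductSpace.rankOne_apply, smul_simpleTensor, map_smul, tensorLeft_apply]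

end Tensor

/-! ### Positive operators and pure states -/

section Positive

variable {H : Type*} [NormedAddCommGroup H] [InnerProductSpace ℂ H] [CompleteSpace H]

/-- The null vectors of the quadratic form of a positive operator `T` lie in its kernel, since
`⟨v, T v⟩ = ‖T^{1/2} v‖²`. -/
theorem apply_eq_zero_of_isPositive {T : H →L[ℂ] H} (hT : T.IsPositive) {v : H}
    (h : (inner ℂ v (T v)).re = 0) : T v = 0 := by
  have h0 : 0 ≤ T := (ContinuousLinearMap.nonneg_iff_isPositive T).2 hT
  have hsq : ∀ w, CFC.sqrt T (CFC.sqrt T w) = T w := fun w =>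
    congrArg (· w) (CFC.sqrt_mul_sqrt_self T h0)
  have hsym : inner ℂ v (T v) = inner ℂ (CFC.sqrt T v) (CFC.sqrt T v) := by
    rw [← hsq]
    exact (((ContinuousLinearMap.nonneg_iff_isPositive _).1
      (CFC.sqrt_nonneg T)).isSymmetric _ _).symm
  have hz : CFC.sqrt T v = 0 := by
    rw [hsym] at h
    exact (inner_self_eq_zero (𝕜 := ℂ)).1 (Complex.ext h (inner_self_im (𝕜 := ℂ) _))
  rw [← hsq, hz, map_zero]

theorem isDensityOperator_rankOne_self {x : H} (hx : ‖x‖ = 1) :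
    IsDensityOperator (InnerProductSpace.rankOne ℂ x x) := by
  have hsum := (basis H).hasSum_inner_mul_inner x x
  have hval : ∀ i, inner ℂ (basis H i) (InnerProductSpace.rankOne ℂ x x (basis H i)) =
      inner ℂ x (basis H i) * inner ℂ (basis H i) x := fun i => by
    simp
  have hpos : (InnerProductSpace.rankOne ℂ x x).IsPositive :=
    InnerProductSpace.isPositive_rankOne_self x
  refine ⟨hpos, ?_, ?_⟩
  · rw [IsTraceClass, CFC.abs_of_nonneg _ ((ContinuousLinearMap.nonneg_iff_isPositive _).2 hpos)]
    simp only [hval]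
    exact (Complex.hasSum_re hsum).summable
  · rw [trace]
    simp only [hval, hsum.tsum_eq, inner_self_eq_norm_sq_to_K, hx]
    simp

theorem IsDensityOperator.exists_apply_ne_zero {T : H →L[ℂ] H} (hT : IsDensityOperator T) :
    ∃ y, T y ≠ 0 := by
  by_contra! h
  have : trace T = 0 := by simp [trace, h]
  exact one_ne_zero (hT.trace_eq_one.symm.trans this)

end Positive

/-! ### Factorization of the interaction on a vector of the probe -/

section Factorization

/-- If `f x` is a multiple of `V x` for every `x`, the factor does not depend on `x`. The
hypothesis is stated by duality: `f x` is orthogonal to everything that `V x` is orthogonal to. -/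
theorem exists_eq_smul_of_orthogonal {H K : Type*}
    [NormedAddCommGroup H] [InnerProductSpace ℂ H] [NormedAddCommGroup K] [InnerProductSpace ℂ K]
    (V : H ≃ₗᵢ[ℂ] K) (f : H →L[ℂ] K)
    (h : ∀ x ξ, inner ℂ (V x) ξ = 0 → inner ℂ ξ (f x) = 0) : ∃ c : ℂ, ∀ x, f x = c • V x := by
  have hspan : ∀ x, ∃ c : ℂ, c • V x = f x := fun x => by
    rw [← Submodule.mem_span_singleton, ← Submodule.orthogonal_orthogonal (ℂ ∙ V x)]
    exact fun ξ hξ => h x ξ (Submodule.mem_orthogonal_singleton_iff_inner_right.1 hξ)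
  obtain ⟨c, hc⟩ := LinearMap.exists_eq_smul_id_of_forall_notLinearIndependent
    (f := (V.symm.toLinearEquiv : K →ₗ[ℂ] H) ∘ₗ (f : H →ₗ[ℂ] K)) fun x hli => by
      obtain ⟨c, hc⟩ := hspan x
      have := LinearIndependent.pair_iff.1 hli c (-1) (by simp [← hc])
      simp at this
  refine ⟨c, fun x => V.symm.injective ?_⟩
  simpa using congrArg (· x) hc

variable {S P S' P' : Type*}
  [NormedAddCommGroup S] [InnerProductSpace ℂ S] [CompleteSpace S]
  [NormedAddCommGroup P] [InnerProductSpace ℂ P] [CompleteSpace P]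
  [NormedAddCommGroup S'] [InnerProductSpace ℂ S'] [CompleteSpace S']
  [NormedAddCommGroup P'] [InnerProductSpace ℂ P'] [CompleteSpace P']
  {V : S ≃ₗᵢ[ℂ] S'} {M : SystemEnvironmentModel S P S' P'}

/-- The output state for the pure input `|x⟩⟨x|` is `|V x⟩⟨V x|`, whose expectation in `ξ ⟂ V x`
vanishes. That expectation is a sum of the nonnegative numbers
`⟨ξ ⊗ eᵢ, U (|x⟩⟨x| ⊗ ρ) U† (ξ ⊗ eᵢ)⟩`, so each of them is zero. -/
theorem inner_basis_eq_zero (hM : M.Implements (unitaryChannel V)) {x : S} (hx : ‖x‖ = 1)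
    {ξ : S'} (hξ : inner ℂ (V x) ξ = 0) (i : basisSet P') (y : P) :
    inner ℂ (simpleTensor ξ (basis P' i)) (M.U (simpleTensor x (M.probe y))) = 0 := by
  set T := unitaryOp M.U ∘L tensorOp (InnerProductSpace.rankOne ℂ x x) M.probe ∘L
    (unitaryOp M.U)† with hT
  set F : basisSet P' → (S' →L[ℂ] S') := fun i =>
    (tensorRight S' (basis P' i))† ∘L T ∘L tensorRight S' (basis P' i) with hF
  have hout : unitaryChannel V (InnerProductSpace.rankOne ℂ x x) = ∑' i, F i :=
    hM _ (isDensityOperator_rankOne_self hx)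
  have hchan : ∀ η, unitaryChannel V (InnerProductSpace.rankOne ℂ x x) η =
      inner ℂ (V x) η • V x := fun η => by
    simp only [unitaryChannel, ContinuousLinearMap.comp_apply, InnerProductSpace.rankOne_apply,
      ContinuousLinearMap.adjoint_inner_right, map_smul]
    rfl
  -- A divergent series would have the junk value `0`, but the output state is not zero.
  have hsummable : Summable F := by
    by_contra hns
    have h0 := hchan (V x)
    rw [hout, tsum_eq_zero_of_not_summable hns] at h0
    have h1 : inner ℂ (V x) (V x) = (1 : ℂ) := by simp [inner_self_eq_norm_sq_to_K, hx]
    rw [h1, one_smul] at h0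
    have h2 : ‖V x‖ = 0 := by rw [← h0]; simp
    rw [V.norm_map, hx] at h2
    exact one_ne_zero h2
  have hsum : HasSum (fun i => (inner ℂ ξ (F i ξ)).re) 0 := by
    have h1 := hsummable.hasSum
    rw [← hout] at h1
    have h2 := Complex.hasSum_re (h1.mapL (innerSL ℂ ξ ∘L ContinuousLinearMap.apply ℂ S' ξ))
    simpa [hchan, hξ] using h2
  set w : basisSet P' → P := fun i =>
    ((tensorLeft P x)†) (((unitaryOp M.U)†) (simpleTensor ξ (basis P' i))) with hw
  have hterm : ∀ i, inner ℂ ξ (F i ξ) = inner ℂ (w i) (M.probe (w i)) := fun i => by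
    simp only [hF, hT, hw, tensorOp_rankOne_self, ContinuousLinearMap.comp_apply,
      ContinuousLinearMap.adjoint_inner_right, ContinuousLinearMap.adjoint_inner_left,
      tensorRight_apply]
  simp only [hterm] at hsum
  have hpos := M.isDensityOperator_probe.isPositive
  have hzero : (inner ℂ (w i) (M.probe (w i))).re = 0 := congrFun
    ((hasSum_zero_iff_of_nonneg fun i => (hpos.re_inner_nonneg_right (w i))).1 hsum) i
  have hker : M.probe (w i) = 0 := apply_eq_zero_of_isPositive hpos hzero
  calc _ = inner ℂ (w i) (M.probe y) := by
        simp only [hw, ContinuousLinearMap.adjoint_inner_left, tensorLeft_apply]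
        rfl
    _ = inner ℂ (M.probe (w i)) y := (hpos.isSymmetric _ _).symm
    _ = 0 := by rw [hker, inner_zero_left]

/-- The preceding orthogonality for all vectors: in `x` by homogeneity, in the environment vector
by density of the span of the basis. -/
theorem inner_simpleTensor_eq_zero (hM : M.Implements (unitaryChannel V)) (x : S) {ξ : S'}
    (hξ : inner ℂ (V x) ξ = 0) (b : P') (y : P) :
    inner ℂ (simpleTensor ξ b) (M.U (simpleTensor x (M.probe y))) = 0 := by
  rcases eq_or_ne x 0 with rfl | hx
  · have : simpleTensor (0 : S) (M.probe y) = 0 := map_zero (tensorRight S _)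
    rw [this, map_zero, inner_zero_right]
  have hx' : (‖x‖ : ℂ) ≠ 0 := by simpa using hx
  have hunit : ‖(‖x‖ : ℂ)⁻¹ • x‖ = 1 := by
    rw [norm_smul, norm_inv, Complex.norm_real, norm_norm, inv_mul_cancel₀ (norm_ne_zero_iff.2 hx)]
  have hbasis : ∀ i,
      inner ℂ (M.U (simpleTensor x (M.probe y))) (simpleTensor ξ (basis P' i)) = 0 := fun i => by
    have h := inner_basis_eq_zero hM hunit (ξ := ξ)
      (by rw [map_smul, inner_smul_left, hξ, mul_zero]) i y
    rw [smul_simpleTensor, map_smul, inner_smul_right] at h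
    exact inner_eq_zero_symm.1 ((mul_eq_zero.1 h).resolve_left (inv_ne_zero hx'))
  have hext : innerSL ℂ (M.U (simpleTensor x (M.probe y))) ∘L tensorLeft P' ξ = 0 := by
    refine ContinuousLinearMap.ext_on (s := Set.range (basis P'))
      (Submodule.dense_iff_topologicalClosure_eq_top.2 (basis P').dense_span) ?_
    rintro _ ⟨i, rfl⟩
    simpa using hbasis i
  exact inner_eq_zero_symm.1 (congrArg (· b) hext)

/-- A model implementing a unitary channel factorizes on every vector `ρ y` of the range of the
probe state: it acts as `V` on the system, and the environment ends in a vector `ψ` that does not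
depend on the system. -/
theorem exists_factorization [Nontrivial S] (hM : M.Implements (unitaryChannel V)) (y : P) :
    ∃ ψ : P', ∀ x, M.U (simpleTensor x (M.probe y)) = simpleTensor (V x) ψ := by
  obtain ⟨x₀, hx₀⟩ := exists_norm_eq S zero_le_one
  -- For fixed `b`, the operator `⟨b|_{P'} U (· ⊗ ρ y)` is a multiple of `V`.
  have hfac : ∀ b : P', ∃ c : ℂ, ∀ x ξ,
      inner ℂ (simpleTensor ξ b) (M.U (simpleTensor x (M.probe y))) = c * inner ℂ ξ (V x) := by
    intro b
    set f : S →L[ℂ] S' :=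
      (tensorRight S' b)† ∘L unitaryOp M.U ∘L tensorRight S (M.probe y) with hf
    have hinner : ∀ x ξ, inner ℂ ξ (f x) =
        inner ℂ (simpleTensor ξ b) (M.U (simpleTensor x (M.probe y))) := fun x ξ => by
      simp only [hf, ContinuousLinearMap.comp_apply, ContinuousLinearMap.adjoint_inner_right]
      rfl
    obtain ⟨c, hc⟩ := exists_eq_smul_of_orthogonal V f fun x ξ hξ => by
      rw [hinner]
      exact inner_simpleTensor_eq_zero hM x hξ b y
    exact ⟨c, fun x ξ => by rw [← hinner, hc, inner_smul_right]⟩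
  -- Testing against `ξ = V x₀` identifies the factor as `⟨b, ψ⟩` for the following `ψ`.
  refine ⟨((tensorLeft P' (V x₀))†) (M.U (simpleTensor x₀ (M.probe y))), fun x => ?_⟩
  refine ext_inner_simpleTensor fun ξ b => ?_
  obtain ⟨c, hc⟩ := hfac b
  have hone : inner ℂ (V x₀) (V x₀) = (1 : ℂ) := by
    simp [inner_self_eq_norm_sq_to_K, hx₀]
  rw [inner_simpleTensor, ContinuousLinearMap.adjoint_inner_right, tensorLeft_apply, hc, hc, hone]
  ring

end Factorization

/-! ### Representations that agree up to scalars -/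

section Phase

variable {G : Type*} [Group G] [TopologicalSpace G]
  {H : Type*} [NormedAddCommGroup H] [InnerProductSpace ℂ H] [CompleteSpace H]

/-- If two unitary representations of a connected group are proportional near the identity, they
are proportional everywhere: the elements where they are form an open subgroup. -/
theorem exists_smul_eq_of_eventually [IsTopologicalGroup G] [ConnectedSpace G]
    {R Q : G →* unitary (H →L[ℂ] H)}
    (h : ∀ᶠ g in nhds (1 : G), ∃ c : ℂ, (Q g : H →L[ℂ] H) = c • (R g : H →L[ℂ] H)) (g : G) :
    ∃ c : ℂ, (Q g : H →L[ℂ] H) = c • (R g : H →L[ℂ] H) := by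
  let N : Subgroup G :=
    { carrier := {g | ∃ c : ℂ, (Q g : H →L[ℂ] H) = c • (R g : H →L[ℂ] H)}
      one_mem' := ⟨1, by simp⟩
      mul_mem' := by
        rintro a b ⟨c, hc⟩ ⟨d, hd⟩
        exact ⟨c * d, by simp [hc, hd, smul_smul, mul_comm]⟩
      -- The inverse of a unitary is its adjoint, so the factor is conjugated.
      inv_mem' := by
        rintro a ⟨c, hc⟩
        refine ⟨star c, ?_⟩
        simp only [map_inv, ← Unitary.star_eq_inv, Unitary.coe_star, hc, star_smul] }
  have hopen : IsOpen (N : Set G) := N.isOpen_of_mem_nhds h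
  have huniv : (N : Set G) = Set.univ :=
    IsClopen.eq_univ ⟨N.isClosed_of_isOpen hopen, hopen⟩ ⟨1, N.one_mem⟩
  exact Set.eq_univ_iff_forall.1 huniv g

/-- The scalars relating two proportional strongly continuous unitary representations form a
continuous character: with a unit vector `x`, they are `⟨R g x, Q g x⟩`. -/
theorem exists_character {R Q : G →* unitary (H →L[ℂ] H)}
    (hR : StronglyContinuous R) (hQ : StronglyContinuous Q)
    (h : ∀ g, ∃ c : ℂ, (Q g : H →L[ℂ] H) = c • (R g : H →L[ℂ] H)) :
    ∃ c : G →ₜ* Circle, ∀ g, (Q g : H →L[ℂ] H) = (c g : ℂ) • (R g : H →L[ℂ] H) := by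
  rcases subsingleton_or_nontrivial H with hH | hH
  · exact ⟨1, fun g => Subsingleton.elim _ _⟩
  obtain ⟨x, hx⟩ := exists_norm_eq H zero_le_one
  have hnorm : ∀ (T : unitary (H →L[ℂ] H)) (v : H), ‖(T : H →L[ℂ] H) v‖ = ‖v‖ := fun T v =>
    ContinuousLinearMap.norm_map_of_mem_unitary T.2 v
  set c : G → ℂ := fun g => inner ℂ ((R g : H →L[ℂ] H) x) ((Q g : H →L[ℂ] H) x) with hc
  have hQc : ∀ g, (Q g : H →L[ℂ] H) = c g • (R g : H →L[ℂ] H) := fun g => by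
    obtain ⟨d, hd⟩ := h g
    have : c g = d := by
      simp [hc, hd, inner_self_eq_norm_sq_to_K, hnorm, hx]
    rw [this, hd]
  have hinj : ∀ g (a b : ℂ), a • (R g : H →L[ℂ] H) = b • (R g : H →L[ℂ] H) → a = b := by
    intro g a b hab
    have h1 : a • (R g : H →L[ℂ] H) x = b • (R g : H →L[ℂ] H) x := congrArg (· x) hab
    refine smul_left_injective ℂ (m := (R g : H →L[ℂ] H) x) ?_ h1
    rw [← norm_ne_zero_iff, hnorm, hx]
    exact one_ne_zero
  have hcirc : ∀ g, c g ∈ Submonoid.unitSphere ℂ := fun g => by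
    have h1 : ‖c g • (R g : H →L[ℂ] H) x‖ = ‖x‖ := by
      rw [← hnorm (Q g) x, hQc g]; rfl
    rw [norm_smul, hnorm, hx, mul_one] at h1
    simpa [Submonoid.unitSphere] using h1
  refine ⟨⟨⟨⟨fun g => ⟨c g, hcirc g⟩, ?_⟩, ?_⟩, ?_⟩, hQc⟩
  · refine Subtype.ext (hinj 1 _ _ ?_)
    rw [← hQc]
    simp
  · intro a b
    refine Subtype.ext (hinj (a * b) _ _ ?_)
    rw [← hQc, map_mul, map_mul, Submonoid.coe_mul, Submonoid.coe_mul, hQc a, hQc b,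
      smul_mul_smul_comm]
    rfl
  · exact Continuous.subtype_mk ((hR x).inner (hQ x)) _

end Phase

/-! ### Matrix elements of the invariance condition -/

section Invariance

variable {S P S' P' : Type*}
  [NormedAddCommGroup S] [InnerProductSpace ℂ S] [CompleteSpace S]
  [NormedAddCommGroup P] [InnerProductSpace ℂ P] [CompleteSpace P]
  [NormedAddCommGroup S'] [InnerProductSpace ℂ S'] [CompleteSpace S']
  [NormedAddCommGroup P'] [InnerProductSpace ℂ P'] [CompleteSpace P']
  {G : Type*} [Group G]

/-- The representation `g ↦ V† R_g V` on `S` obtained by transporting `R` along `V`. -/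
noncomputable def transport (V : S ≃ₗᵢ[ℂ] S') (R : G →* unitary (S' →L[ℂ] S')) :
    G →* unitary (S →L[ℂ] S) :=
  (Unitary.map (StarMonoidHom.ofClass V.symm.conjStarAlgEquiv)).toMonoidHom.comp R

theorem transport_apply (V : S ≃ₗᵢ[ℂ] S') (R : G →* unitary (S' →L[ℂ] S')) (g : G) (x : S) :
    (transport V R g : S →L[ℂ] S) x = V.symm ((R g : S' →L[ℂ] S') (V x)) := rfl

theorem coe_transport (V : S ≃ₗᵢ[ℂ] S') (R : G →* unitary (S' →L[ℂ] S')) (g : G) :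
    (transport V R g : S →L[ℂ] S) =
      (unitaryOp V)† ∘L (R g : S' →L[ℂ] S') ∘L unitaryOp V := by
  ext x
  refine ext_inner_left ℂ fun v => ?_
  rw [ContinuousLinearMap.comp_apply, ContinuousLinearMap.adjoint_inner_right, transport_apply,
    ← V.inner_map_map, V.apply_symm_apply]
  rfl

/-- The matrix elements of the invariance condition between `x ⊗ φ` and `z ⊗ φ`, when the
interaction maps `x ⊗ φ` to `V x ⊗ ψ` for all `x`. -/
theorem smul_eq_smul_transport {V : S ≃ₗᵢ[ℂ] S'} {M : SystemEnvironmentModel S P S' P'}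
    {RS : G →* unitary (S →L[ℂ] S)} {RP : G →* unitary (P →L[ℂ] P)}
    {RS' : G →* unitary (S' →L[ℂ] S')} {RP' : G →* unitary (P' →L[ℂ] P')}
    (hinv : M.GInvariant RS RP RS' RP') {φ : P} {ψ : P'}
    (hψ : ∀ x, M.U (simpleTensor x φ) = simpleTensor (V x) ψ) (g : G) :
    inner ℂ φ ((RP g : P →L[ℂ] P) φ) • (RS g : S →L[ℂ] S) =
      inner ℂ ψ ((RP' g : P' →L[ℂ] P') ψ) • (transport V RS' g : S →L[ℂ] S) := by
  ext x
  refine ext_inner_left ℂ fun v => ?_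
  have hcoe : ∀ w, unitaryOp M.U w = M.U w := fun _ => rfl
  have h := congrArg (fun T => inner ℂ (simpleTensor v φ) (T (simpleTensor x φ))) (hinv g)
  simp only [ContinuousLinearMap.comp_apply, ContinuousLinearMap.adjoint_inner_right, hcoe, hψ,
    tensorOp_simpleTensor, inner_simpleTensor] at h
  have hV : inner ℂ v ((transport V RS' g : S →L[ℂ] S) x) =
      inner ℂ (V v) ((RS' g : S' →L[ℂ] S') (V x)) := by
    rw [transport_apply, ← V.inner_map_map, V.apply_symm_apply]
  simp only [smul_apply, inner_smul_right, hV]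
  linear_combination -h

end Invariance

end WAY

theorem theoremS2
    {S P S' P' : Type*}
    [NormedAddCommGroup S] [InnerProductSpace ℂ S] [CompleteSpace S]
    [NormedAddCommGroup P] [InnerProductSpace ℂ P] [CompleteSpace P]
    [NormedAddCommGroup S'] [InnerProductSpace ℂ S'] [CompleteSpace S']
    [NormedAddCommGroup P'] [InnerProductSpace ℂ P'] [CompleteSpace P']
    (V : S ≃ₗᵢ[ℂ] S')
    (M : WAY.SystemEnvironmentModel S P S' P')
    (hM : M.Implements (WAY.unitaryChannel V))
    {G : Type*} [Group G] [TopologicalSpace G] [IsTopologicalGroup G] [ConnectedSpace G]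
    (RS : G →* unitary (S →L[ℂ] S)) (RP : G →* unitary (P →L[ℂ] P))
    (RS' : G →* unitary (S' →L[ℂ] S')) (RP' : G →* unitary (P' →L[ℂ] P'))
    (hRS : WAY.StronglyContinuous RS) (hRP : WAY.StronglyContinuous RP)
    (hRS' : WAY.StronglyContinuous RS') (hRP' : WAY.StronglyContinuous RP')
    (hinv : M.GInvariant RS RP RS' RP') :
    ∃ c : G →ₜ* Circle, ∀ g : G,
      (WAY.unitaryOp V)† ∘L (RS' g : S' →L[ℂ] S') ∘L WAY.unitaryOp V =
        (c g : ℂ) • (RS g : S →L[ℂ] S) := by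
  rcases subsingleton_or_nontrivial S with hS | hS
  · exact ⟨1, fun g => Subsingleton.elim _ _⟩
  obtain ⟨y, hy⟩ := M.isDensityOperator_probe.exists_apply_ne_zero
  obtain ⟨ψ, hψ⟩ := WAY.exists_factorization hM y
  have hkey := WAY.smul_eq_smul_transport hinv hψ
  have hψ₀ : ψ ≠ 0 := by
    obtain ⟨x, hx⟩ := exists_norm_eq S zero_le_one
    rintro rfl
    have h0 : M.U (WAY.simpleTensor x (M.probe y)) = 0 :=
      (hψ x).trans (map_zero (WAY.tensorLeft P' (V x)))
    have h1 : inner ℂ (M.U (WAY.simpleTensor x (M.probe y)))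
        (M.U (WAY.simpleTensor x (M.probe y))) = 0 := by rw [h0, inner_zero_left]
    rw [M.U.inner_map_map, WAY.inner_simpleTensor, mul_eq_zero, inner_self_eq_zero,
      inner_self_eq_zero] at h1
    refine h1.elim (fun h => ?_) hy
    rw [h, norm_zero] at hx
    exact zero_ne_one hx
  have hcont : WAY.StronglyContinuous (WAY.transport V RS') := fun ξ =>
    V.symm.continuous.comp (hRS' (V ξ))
  -- The coefficient of `V† RS' V` is `‖ψ‖² ≠ 0` at the identity, hence nonzero near it.
  have hnear : ∀ᶠ g in nhds (1 : G), inner ℂ ψ ((RP' g : P' →L[ℂ] P') ψ) ≠ 0 :=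
    (continuous_const.inner (hRP' ψ)).continuousAt.eventually_ne (by simpa using hψ₀)
  have hscalar := WAY.exists_smul_eq_of_eventually (R := RS) (Q := WAY.transport V RS')
    (hnear.mono fun g hg => ⟨_, ((inv_smul_smul₀ hg _).symm.trans
      (congrArg _ (hkey g).symm)).trans (smul_smul _ _ _)⟩)
  obtain ⟨c, hc⟩ := WAY.exists_character hRS hcont hscalar
  exact ⟨c, fun g => (WAY.coe_transport V RS' g).symm.trans (hc g)⟩
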